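/- Let $A$ be a unital $C^*$-algebra that admits a unital $*$-homomorphism $M_2(\mathbb{C}) \oplus M_3(\mathbb{C}) \to A$ (not necessarily injective). A \emph{Dixmier ideal} of $A$ is a (not necessarily closed) two-sided ideal $I \subseteq A$ that is positively spanned ($I = \operatorname{span}_{\mathbb{C}}(I \cap A_+)$), hereditary (if $a, b \in A_+$ satisfy $a \le b$ and $b \in I$, then $a \in I$) and strongly invariant (if $x \in A$ satisfies $x^*x \in I$, then $xx^* \in I$). For a Dixmier ideal $I$, let $I^{1/2}$ denote the unique Dixmier ideal whose set of positive elements is $\{a^{1/2} : a \in I \cap A_+\}$; equivalently, $I^{1/2}$ is the linear span of this set. For subspaces $M, N \subseteq A$, let $[M,N]$ denote the linear span of the commutators $xy - yx$ with $x \in M$, $y \in N$, let $MN$ denote the linear span of the products $xy$ with $x \in M$, $y \in N$, and put $M^2 = MM$. Then every Dixmier ideal $I \subseteq A$ satisfies $$I = [A,I] + [A,I^{1/2}]^2.$$ Moreover, every element of $I$ is a finite sum of elements each of which is either a square-zero element of $I$ (an $x \in I$ with $x^2 = 0$) or a product $uv$ of two square-zero elements $u, v \in I^{1/2}$. -/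

import Mathlib

section CStar

variable {A : Type*} [CStarAlgebra A]

/-- `[M, N]`: the linear subspace generated by the commutators `x * y - y * x` of elements
`x` of `M` and `y` of `N`. -/
noncomputable def commutatorSpan (M N : Submodule ℂ A) : Submodule ℂ A :=
  Submodule.span ℂ {z | ∃ x ∈ M, ∃ y ∈ N, z = x * y - y * x}

variable [PartialOrder A] [StarOrderedRing A]

/-- A Dixmier ideal of the unital C⋆-algebra `A`: a (not necessarily closed) two-sided ideal that
is positively spanned, hereditary and strongly invariant. -/
structure IsDixmierIdeal (I : Submodule ℂ A) : Prop where
  mul_mem_left : ∀ a x : A, x ∈ I → a * x ∈ I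
  mul_mem_right : ∀ a x : A, x ∈ I → x * a ∈ I
  positively_spanned : I = Submodule.span ℂ {a | a ∈ I ∧ 0 ≤ a}
  hereditary : ∀ a b : A, 0 ≤ a → a ≤ b → b ∈ I → a ∈ I
  strongly_invariant : ∀ x : A, star x * x ∈ I → x * star x ∈ I

/-- The ideal `I^{1/2}` of a Dixmier ideal `I`, as the span of the square roots of the positive
elements of `I`. By `IsDixmierIdeal.dixmierSqrt_spec` below it is the unique Dixmier ideal whose set of positive
elements is the set of these square roots. -/
noncomputable def dixmierSqrt (I : Submodule ℂ A) : Submodule ℂ A :=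
  Submodule.span ℂ {b | ∃ a ∈ I, 0 ≤ a ∧ b = CFC.sqrt a}

namespace IsDixmierIdeal

variable {I : Submodule ℂ A}

lemma star_mem (hI : IsDixmierIdeal I) {x : A} (hx : x ∈ I) : star x ∈ I := by
  have hx' := hx
  rw [hI.positively_spanned] at hx'
  induction hx' using Submodule.span_induction with
  | mem y hy =>
    rw [(IsSelfAdjoint.of_nonneg hy.2).star_eq]
    exact hy.1
  | zero => simp
  | add y z hy hz hy' hz' =>
    rw [← hI.positively_spanned] at hy hz
    rw [star_add]
    exact I.add_mem (hy' hy) (hz' hz)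
  | smul c y hy hy' =>
    rw [← hI.positively_spanned] at hy
    rw [star_smul]
    exact I.smul_mem _ (hy' hy)

/-- The square root of `I` consists of the elements `x` with `star x * x ∈ I`. -/
lemma mem_dixmierSqrt_iff (hI : IsDixmierIdeal I) {x : A} :
    x ∈ dixmierSqrt I ↔ star x * x ∈ I := by
  have hadd : ∀ y z : A, star y * y ∈ I → star z * z ∈ I → star (y + z) * (y + z) ∈ I := by
    intro y z hy hz
    refine hI.hereditary _ (star (y + z) * (y + z) + star (y - z) * (y - z))
      (star_mul_self_nonneg _) (le_add_of_nonneg_right (star_mul_self_nonneg _)) ?_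
    have : star (y + z) * (y + z) + star (y - z) * (y - z)
        = (star y * y + star z * z) + (star y * y + star z * z) := by
      simp only [star_add, star_sub]; noncomm_ring
    rw [this]
    exact I.add_mem (I.add_mem hy hz) (I.add_mem hy hz)
  have hsmul : ∀ (c : ℂ) (y : A), star y * y ∈ I → star (c • y) * (c • y) ∈ I := by
    intro c y hy
    rw [star_smul, smul_mul_smul_comm]
    exact I.smul_mem _ hy
  have hsa : ∀ u : A, IsSelfAdjoint u → u * u ∈ I → u ∈ dixmierSqrt I := by
    intro u hu huI
    have hsq : u * u = u⁺ * u⁺ + u⁻ * u⁻ := by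
      conv_lhs => rw [← CFC.posPart_sub_negPart u hu]
      have h1 : u⁺ * u⁻ = 0 := CFC.posPart_mul_negPart u
      have h2 : u⁻ * u⁺ = 0 := CFC.negPart_mul_posPart u
      simp only [mul_sub, sub_mul, h1, h2]
      simp
    have hp : 0 ≤ u⁺ := CFC.posPart_nonneg u
    have hn : 0 ≤ u⁻ := CFC.negPart_nonneg u
    have hpp : 0 ≤ u⁺ * u⁺ := by
      simpa [(IsSelfAdjoint.of_nonneg hp).star_eq] using star_mul_self_nonneg (u⁺)
    have hnn : 0 ≤ u⁻ * u⁻ := by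
      simpa [(IsSelfAdjoint.of_nonneg hn).star_eq] using star_mul_self_nonneg (u⁻)
    have hpI : u⁺ * u⁺ ∈ I :=
      hI.hereditary _ _ hpp (by rw [hsq]; exact le_add_of_nonneg_right hnn) huI
    have hnI : u⁻ * u⁻ ∈ I :=
      hI.hereditary _ _ hnn (by rw [hsq]; exact le_add_of_nonneg_left hpp) huI
    rw [← CFC.posPart_sub_negPart u hu]
    exact Submodule.sub_mem _
      (Submodule.subset_span ⟨_, hpI, hpp, (CFC.sqrt_mul_self _ hp).symm⟩)
      (Submodule.subset_span ⟨_, hnI, hnn, (CFC.sqrt_mul_self _ hn).symm⟩)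
  constructor
  · intro hx
    induction hx using Submodule.span_induction with
    | mem y hy =>
      obtain ⟨a, ha, ha0, rfl⟩ := hy
      rw [(IsSelfAdjoint.of_nonneg (CFC.sqrt_nonneg a)).star_eq, CFC.sqrt_mul_sqrt_self a ha0]
      exact ha
    | zero => simp
    | add y z _ _ hy hz => exact hadd y z hy hz
    | smul c y _ hy => exact hsmul c y hy
  · intro hx
    have hx' : star (star x) * star x ∈ I := by
      rw [star_star]; exact hI.strongly_invariant x hx
    have hre : star (x + star x) * (x + star x) ∈ I := hadd _ _ hx hx'
    have him : star (Complex.I • (x - star x)) * (Complex.I • (x - star x)) ∈ I := by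
      refine hsmul _ _ ?_
      rw [sub_eq_add_neg]
      refine hadd _ _ hx ?_
      simpa using hx'
    have sre : IsSelfAdjoint (x + star x) := IsSelfAdjoint.add_star_self x
    have sim : IsSelfAdjoint (Complex.I • (x - star x)) := by
      rw [isSelfAdjoint_iff, star_smul, star_sub, star_star]
      simp only [Complex.star_def, Complex.conj_I, neg_smul, smul_sub]
      abel
    rw [sre.star_eq] at hre
    rw [sim.star_eq] at him
    have h1 := hsa _ sre hre
    have h2 := hsa _ sim him
    have : x = (1 / 2 : ℂ) • (x + star x)
        + (-(1 / 2) * Complex.I : ℂ) • (Complex.I • (x - star x)) := by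
      rw [smul_smul, mul_assoc, Complex.I_mul_I, smul_add, smul_sub]
      module
    rw [this]
    exact Submodule.add_mem _ (Submodule.smul_mem _ _ h1) (Submodule.smul_mem _ _ h2)

lemma mem_dixmierSqrt_iff_of_nonneg (hI : IsDixmierIdeal I) {b : A} (hb : 0 ≤ b) :
    b ∈ dixmierSqrt I ↔ b * b ∈ I := by
  rw [hI.mem_dixmierSqrt_iff, (IsSelfAdjoint.of_nonneg hb).star_eq]

lemma nonneg_mem_dixmierSqrt_iff (hI : IsDixmierIdeal I) (b : A) :
    (b ∈ dixmierSqrt I ∧ 0 ≤ b) ↔ ∃ a ∈ I, 0 ≤ a ∧ b = CFC.sqrt a := by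
  constructor
  · rintro ⟨hb, hb0⟩
    refine ⟨b * b, (hI.mem_dixmierSqrt_iff_of_nonneg hb0).1 hb, ?_, (CFC.sqrt_mul_self b hb0).symm⟩
    simpa [(IsSelfAdjoint.of_nonneg hb0).star_eq] using star_mul_self_nonneg b
  · rintro ⟨a, ha, ha0, rfl⟩
    exact ⟨Submodule.subset_span ⟨a, ha, ha0, rfl⟩, CFC.sqrt_nonneg a⟩

lemma isDixmierIdeal_dixmierSqrt (hI : IsDixmierIdeal I) : IsDixmierIdeal (dixmierSqrt I) := by
  have hright : ∀ a x : A, x ∈ dixmierSqrt I → x * a ∈ dixmierSqrt I := by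
    intro a x hx
    rw [hI.mem_dixmierSqrt_iff] at hx ⊢
    have : star (x * a) * (x * a) = star a * (star x * x) * a := by
      rw [star_mul]; noncomm_ring
    rw [this]
    exact hI.mul_mem_right _ _ (hI.mul_mem_left _ _ hx)
  have hstar : ∀ x : A, x ∈ dixmierSqrt I → star x ∈ dixmierSqrt I := by
    intro x hx
    rw [hI.mem_dixmierSqrt_iff] at hx ⊢
    rw [star_star]
    exact hI.strongly_invariant x hx
  refine ⟨?_, hright, ?_, ?_, ?_⟩
  · intro a x hx
    have := hstar _ (hright (star a) _ (hstar x hx))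
    simpa using this
  · have : {a | a ∈ dixmierSqrt I ∧ 0 ≤ a} = {b | ∃ a ∈ I, 0 ≤ a ∧ b = CFC.sqrt a} :=
      Set.ext hI.nonneg_mem_dixmierSqrt_iff
    rw [this]
    rfl
  · intro c b hc hcb hb
    have hb0 : 0 ≤ b := hc.trans hcb
    rw [hI.mem_dixmierSqrt_iff_of_nonneg hb0] at hb
    rw [hI.mem_dixmierSqrt_iff_of_nonneg hc]
    set s := CFC.sqrt b
    set t := CFC.sqrt c
    have hs : s * s = b := CFC.sqrt_mul_sqrt_self b hb0
    have ht : t * t = c := CFC.sqrt_mul_sqrt_self c hc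
    have hs0 : 0 ≤ s := CFC.sqrt_nonneg b
    have ht0 : 0 ≤ t := CFC.sqrt_nonneg c
    have hss : star s = s := (IsSelfAdjoint.of_nonneg hs0).star_eq
    have hts : star t = t := (IsSelfAdjoint.of_nonneg ht0).star_eq
    have h1 : s * c * s ∈ I := by
      refine hI.hereditary _ (b * b) ?_ ?_ hb
      · simpa [hss] using star_left_conjugate_nonneg hc s
      · have := conjugate_le_conjugate_of_nonneg hcb hs0
        have e : s * b * s = b * b := by rw [← hs]; noncomm_ring
        rwa [e] at this
    have h2 : t * b * t ∈ I := by
      have := hI.strongly_invariant (t * s) (by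
        rw [star_mul, hss, hts]
        have e : s * t * (t * s) = s * c * s := by rw [← ht]; noncomm_ring
        rwa [e])
      rw [star_mul, hss, hts] at this
      have e : t * s * (s * t) = t * b * t := by rw [← hs]; noncomm_ring
      rwa [e] at this
    refine hI.hereditary _ (t * b * t) ?_ ?_ h2
    · simpa [(IsSelfAdjoint.of_nonneg hc).star_eq] using star_mul_self_nonneg c
    · have := conjugate_le_conjugate_of_nonneg hcb ht0
      have e : t * c * t = c * c := by rw [← ht]; noncomm_ring
      rwa [e] at this
  · intro x hx
    rw [hI.mem_dixmierSqrt_iff_of_nonneg (star_mul_self_nonneg x)] at hx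
    rw [hI.mem_dixmierSqrt_iff_of_nonneg (mul_star_self_nonneg x)]
    set s := CFC.sqrt (star x * x)
    have hs : s * s = star x * x := CFC.sqrt_mul_sqrt_self _ (star_mul_self_nonneg x)
    have hss : star s = s := (IsSelfAdjoint.of_nonneg (CFC.sqrt_nonneg (star x * x))).star_eq
    have := hI.strongly_invariant (x * s) (by
      rw [star_mul, hss]
      have e : s * star x * (x * s) = star x * x * (star x * x) := by
        calc s * star x * (x * s) = s * (star x * x) * s := by noncomm_ring
          _ = (s * s) * (s * s) := by rw [← hs]; noncomm_ring
          _ = _ := by rw [hs]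
      rwa [e])
    rw [star_mul, hss] at this
    have e : x * s * (s * star x) = x * star x * (x * star x) := by
      calc x * s * (s * star x) = x * (s * s) * star x := by noncomm_ring
        _ = _ := by rw [hs]; noncomm_ring
    rwa [e] at this

/-- `dixmierSqrt I` is the unique Dixmier ideal whose positive elements are the square roots of
the positive elements of `I`. -/
theorem dixmierSqrt_spec (hI : IsDixmierIdeal I) (J : Submodule ℂ A) :
    (IsDixmierIdeal J ∧ {b | b ∈ J ∧ 0 ≤ b} = {b | ∃ a ∈ I, 0 ≤ a ∧ b = CFC.sqrt a}) ↔
      J = dixmierSqrt I := by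
  constructor
  · rintro ⟨hJ, h⟩
    rw [hJ.positively_spanned, h]
    rfl
  · rintro rfl
    exact ⟨hI.isDixmierIdeal_dixmierSqrt, Set.ext hI.nonneg_mem_dixmierSqrt_iff⟩

end IsDixmierIdeal

end CStar

/-! Write `J` for `dixmierSqrt I`. Since `I = J * J`, it suffices to treat `x * y` with `x, y ∈ J`.
The images in `A` of the diagonal matrix units are orthogonal idempotents `p i` with sum `1`, so `x
* y` is the sum of the terms `p i * x * p j * y * p k`.

If `i ≠ k`, the term `c` satisfies `p i * c = c` and `c * p i = 0`, so it equals `[p i, c]` and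
squares to zero. If `i = k ≠ j`, it splits at `p j` into two such off-diagonal factors in `J`. If `i
= j = k`, the middle `p i` is first factored through another diagonal unit, possible because both
blocks have size at least two; this again gives two off-diagonal factors. Both claims follow from
this one decomposition (`mul_mem_of_peirce`, `IsDixmierIdeal.mem_of_offDiagonal`). -/

/-- The diagonal matrix units of `M₂ × M₃` form a finite partition of unity into orthogonal
idempotents, each of which factors as `a * b` with `a * p = 0` and `p * b = 0`. -/
lemma exists_idempotents_matrix_prod :
    ∃ p a b : Fin 2 ⊕ Fin 3 → Matrix (Fin 2) (Fin 2) ℂ × Matrix (Fin 3) (Fin 3) ℂ,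
      ∑ i, p i = 1 ∧ (∀ i, p i * p i = p i) ∧ (∀ i j, i ≠ j → p i * p j = 0) ∧
        ∀ i, a i * b i = p i ∧ a i * p i = 0 ∧ p i * b i = 0 := by
  -- Addition in `Fin n` is cyclic, so `i + 1` is always a valid index different from `i`.
  have h2 : ∀ i : Fin 2, i + 1 ≠ i := by decide
  have h3 : ∀ i : Fin 3, i + 1 ≠ i := by decide
  refine ⟨Sum.elim (fun i ↦ (Matrix.single i i 1, 0)) (fun i ↦ (0, Matrix.single i i 1)),
    Sum.elim (fun i ↦ (Matrix.single i (i + 1) 1, 0)) (fun i ↦ (0, Matrix.single i (i + 1) 1)),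
    Sum.elim (fun i ↦ (Matrix.single (i + 1) i 1, 0)) (fun i ↦ (0, Matrix.single (i + 1) i 1)),
    ?_, ?_, ?_, ?_⟩
  · rw [Fintype.sum_sum_type]
    refine Prod.ext ?_ ?_
    · simpa [Prod.fst_sum] using Matrix.sum_single_one (m := Fin 2) (α := ℂ)
    · simpa [Prod.snd_sum] using Matrix.sum_single_one (m := Fin 3) (α := ℂ)
  · rintro (i | i) <;> simp
  · rintro (i | i) (j | j) hij
    · have : i ≠ j := fun h ↦ hij (by rw [h])
      simp [Matrix.single_mul_single_of_ne _ _ _ _ this]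
    · simp
    · simp
    · have : i ≠ j := fun h ↦ hij (by rw [h])
      simp [Matrix.single_mul_single_of_ne _ _ _ _ this]
  · rintro (i | i)
    · simp [Matrix.single_mul_single_of_ne _ _ _ _ (h2 i),
        Matrix.single_mul_single_of_ne _ _ _ _ (h2 i).symm]
    · simp [Matrix.single_mul_single_of_ne _ _ _ _ (h3 i),
        Matrix.single_mul_single_of_ne _ _ _ _ (h3 i).symm]

/-- Peirce decomposition of a product: if the unit is a finite sum of orthogonal idempotents `p i`,
each factoring as `a i * b i` with `a i * p i = 0` and `p i * b i = 0`, then `x * y` is a sum of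
off-diagonal elements and of products of two off-diagonal elements. -/
lemma mul_mem_of_peirce {R ι : Type*} [Ring R] [Fintype ι] {p a b : ι → R}
    (hsum : ∑ i, p i = 1) (hidem : ∀ i, p i * p i = p i) (horth : ∀ i j, i ≠ j → p i * p j = 0)
    (hab : ∀ i, a i * b i = p i) (hap : ∀ i, a i * p i = 0) (hpb : ∀ i, p i * b i = 0)
    (S : AddSubmonoid R) (x y : R)
    (hoff : ∀ q r s : R, q * q = q → q * r = 0 → r * q = 0 → q * x * s * y * r ∈ S)
    (hprod : ∀ q r s : R, q * q = q → r * q = 0 → q * s = 0 →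
      (q * x * r) * (s * y * q) ∈ S) :
    x * y ∈ S := by
  have key : x * y = ∑ i, ∑ j, ∑ k, p i * x * p j * y * p k := by
    simp_rw [← Finset.mul_sum, hsum, ← Finset.sum_mul, ← Finset.mul_sum, hsum,
      ← Finset.sum_mul, hsum]
    simp
  rw [key]
  refine sum_mem fun i _ ↦ sum_mem fun j _ ↦ sum_mem fun k _ ↦ ?_
  by_cases hik : i = k
  · subst hik
    by_cases hij : i = j
    · subst hij
      -- The detour `p i = a i * b i` makes the left factor vanish when multiplied by `p i` on the
      -- right, and the right factor when multiplied by it on the left.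
      have := hprod (p i) (p i * a i) (b i * p i) (hidem i) (by rw [mul_assoc, hap, mul_zero])
        (by rw [← mul_assoc, hpb, zero_mul])
      convert this using 1
      calc p i * x * p i * y * p i = p i * x * (p i * p i * p i) * y * p i := by
            rw [hidem, hidem]
        _ = p i * x * (p i * (a i * b i) * p i) * y * p i := by rw [hab]
        _ = _ := by noncomm_ring
    · have := hprod (p i) (p j) (p j) (hidem i) (horth _ _ (Ne.symm hij)) (horth _ _ hij)
      convert this using 1
      calc p i * x * p j * y * p i = p i * x * (p j * p j) * y * p i := by rw [hidem]
        _ = _ := by noncomm_ring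
  · exact hoff (p i) (p k) (p j) (hidem i) (horth _ _ hik) (horth _ _ (Ne.symm hik))

section DixmierIdeal

variable {A : Type*} [CStarAlgebra A]

/-- Such a `u` is its own commutator with `q`: `u = [q, u]`. -/
lemma mem_commutatorSpan_top_of_mul_eq {M : Submodule ℂ A} {q u : A} (hu : u ∈ M)
    (hqu : q * u = u) (huq : u * q = 0) : u ∈ commutatorSpan ⊤ M :=
  Submodule.subset_span ⟨q, Submodule.mem_top, u, hu, by rw [hqu, huq, sub_zero]⟩

lemma mem_commutatorSpan_top_of_mul_eq' {M : Submodule ℂ A} {q u : A} (hu : u ∈ M)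
    (huq : u * q = u) (hqu : q * u = 0) : u ∈ commutatorSpan ⊤ M := by
  -- Here `[q, u] = -u`, hence the sign.
  refine Submodule.subset_span ⟨-q, Submodule.mem_top, u, hu, ?_⟩
  rw [neg_mul, mul_neg, hqu, huq]
  simp

variable [PartialOrder A] {I : Submodule ℂ A}

lemma IsDixmierIdeal.commutatorSpan_top_le (hI : IsDixmierIdeal I) : commutatorSpan ⊤ I ≤ I := by
  refine Submodule.span_le.2 ?_
  rintro _ ⟨x, -, y, hy, rfl⟩
  exact I.sub_mem (hI.mul_mem_left _ _ hy) (hI.mul_mem_right _ _ hy)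

variable [StarOrderedRing A]

/-- Polarization: `x * y` is a combination of squares `star w * w` with `w ∈ dixmierSqrt I`, each of
which lies in `I`. -/
lemma IsDixmierIdeal.mul_mem_of_mem_dixmierSqrt (hI : IsDixmierIdeal I) {x y : A}
    (hx : x ∈ dixmierSqrt I) (hy : y ∈ dixmierSqrt I) : x * y ∈ I := by
  have hx' : star x ∈ dixmierSqrt I := hI.isDixmierIdeal_dixmierSqrt.star_mem hx
  have hsq : ∀ c : ℂ, star (star x + c • y) * (star x + c • y) ∈ I := fun c ↦
    hI.mem_dixmierSqrt_iff.1 (Submodule.add_mem _ hx' (Submodule.smul_mem _ c hy))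
  have h0 := hI.mem_dixmierSqrt_iff.1 hx'
  have h1 := hI.mem_dixmierSqrt_iff.1 hy
  -- Without their diagonal terms, the squares for `c = 1` and `c = Complex.I` give `x * y + star y
  -- * star x` and, after scaling, `x * y - star y * star x`; their mean is `x * y`.
  have e1 := I.sub_mem (I.sub_mem (hsq 1) h0) h1
  have e2 := I.smul_mem (-Complex.I) (I.sub_mem (I.sub_mem (hsq Complex.I) h0) h1)
  have h := I.smul_mem (1 / 2 : ℂ) (I.add_mem e1 e2)
  convert h using 1
  simp only [star_add, star_star, star_smul, one_smul, add_mul, mul_add,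
    smul_mul_assoc, mul_smul_comm, smul_add, smul_sub, smul_smul, Complex.star_def,
    Complex.conj_I]
  match_scalars <;> simp; ring

/-- A Dixmier ideal is the square of its square root. -/
lemma IsDixmierIdeal.dixmierSqrt_mul_dixmierSqrt (hI : IsDixmierIdeal I) :
    dixmierSqrt I * dixmierSqrt I = I := by
  refine le_antisymm (Submodule.mul_le.2 fun x hx y hy ↦ hI.mul_mem_of_mem_dixmierSqrt hx hy) ?_
  conv_lhs => rw [hI.positively_spanned]
  refine Submodule.span_le.2 ?_
  rintro a ⟨ha, ha0⟩
  have hs : CFC.sqrt a ∈ dixmierSqrt I := Submodule.subset_span ⟨a, ha, ha0, rfl⟩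
  rw [← CFC.sqrt_mul_sqrt_self a ha0]
  exact Submodule.mul_mem_mul hs hs

/-- An additive submonoid contains the Dixmier ideal `I` as soon as it contains the off-diagonal
elements of `I` and the products of off-diagonal elements of `dixmierSqrt I`. -/
lemma IsDixmierIdeal.mem_of_offDiagonal (hI : IsDixmierIdeal I)
    (hA : Nonempty ((Matrix (Fin 2) (Fin 2) ℂ × Matrix (Fin 3) (Fin 3) ℂ) →⋆ₐ[ℂ] A))
    (S : AddSubmonoid A) (hoff : ∀ q, ∀ c ∈ I, q * c = c → c * q = 0 → c ∈ S)
    (hprod : ∀ q, ∀ u ∈ dixmierSqrt I, ∀ v ∈ dixmierSqrt I,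
      q * u = u → u * q = 0 → v * q = v → q * v = 0 → u * v ∈ S)
    {x : A} (hx : x ∈ I) : x ∈ S := by
  obtain ⟨φ⟩ := hA
  obtain ⟨p, a, b, hsum, hidem, horth, hab⟩ := exists_idempotents_matrix_prod
  have hJ := hI.isDixmierIdeal_dixmierSqrt
  rw [← hI.dixmierSqrt_mul_dixmierSqrt] at hx
  refine Submodule.mul_induction_on hx (fun y hy z hz ↦ ?_) fun _ _ ↦ S.add_mem
  refine mul_mem_of_peirce (p := fun i ↦ φ (p i)) (a := fun i ↦ φ (a i)) (b := fun i ↦ φ (b i))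
    (by rw [← map_sum, hsum, map_one]) (fun i ↦ by rw [← map_mul, hidem])
    (fun i j h ↦ by rw [← map_mul, horth i j h, map_zero])
    (fun i ↦ by rw [← map_mul, (hab i).1])
    (fun i ↦ by rw [← map_mul, (hab i).2.1, map_zero])
    (fun i ↦ by rw [← map_mul, (hab i).2.2, map_zero]) S y z ?_ ?_
  · intro q r s hq hqr hrq
    refine hoff q _ ?_ ?_ ?_
    · exact hI.mul_mem_right _ _ (hI.mul_mem_of_mem_dixmierSqrt
        (hJ.mul_mem_right _ _ (hJ.mul_mem_left _ _ hy)) hz)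
    · simp only [← mul_assoc, hq]
    · rw [mul_assoc, hrq, mul_zero]
  · intro q r s hq hrq hqs
    refine hprod q _ (hJ.mul_mem_right _ _ (hJ.mul_mem_left _ _ hy))
      _ (hJ.mul_mem_right _ _ (hJ.mul_mem_left _ _ hz)) ?_ ?_ ?_ ?_
    · simp only [← mul_assoc, hq]
    · rw [mul_assoc, hrq, mul_zero]
    · rw [mul_assoc, hq]
    · simp only [← mul_assoc, hqs, zero_mul]

end DixmierIdeal

theorem mainTheorem7 {A : Type*} [CStarAlgebra A] [PartialOrder A] [StarOrderedRing A]
    (hA : Nonempty ((Matrix (Fin 2) (Fin 2) ℂ × Matrix (Fin 3) (Fin 3) ℂ) →⋆ₐ[ℂ] A))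
    (I : Submodule ℂ A) (hI : IsDixmierIdeal I) :
    I = commutatorSpan ⊤ I
        + commutatorSpan ⊤ (dixmierSqrt I) * commutatorSpan ⊤ (dixmierSqrt I) ∧
    ∀ x ∈ I, x ∈ AddSubmonoid.closure
      ({y : A | y ∈ I ∧ y * y = 0} ∪
        {z : A | ∃ u ∈ dixmierSqrt I, ∃ v ∈ dixmierSqrt I,
          u * u = 0 ∧ v * v = 0 ∧ z = u * v}) := by
  refine ⟨le_antisymm (fun x hx ↦ ?_) ?_, fun x hx ↦ ?_⟩
  · refine hI.mem_of_offDiagonal hA (Submodule.toAddSubmonoid _) ?_ ?_ hx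
    · exact fun q c hc hqc hcq ↦
        Submodule.mem_sup_left (mem_commutatorSpan_top_of_mul_eq hc hqc hcq)
    · exact fun q u hu v hv hqu huq hvq hqv ↦ Submodule.mem_sup_right <|
        Submodule.mul_mem_mul (mem_commutatorSpan_top_of_mul_eq hu hqu huq)
          (mem_commutatorSpan_top_of_mul_eq' hv hvq hqv)
  · have hJ := hI.isDixmierIdeal_dixmierSqrt.commutatorSpan_top_le
    exact sup_le hI.commutatorSpan_top_le
      ((mul_le_mul' hJ hJ).trans hI.dixmierSqrt_mul_dixmierSqrt.le)
  · refine hI.mem_of_offDiagonal hA _ ?_ ?_ hx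
    · intro q c hc hqc hcq
      refine AddSubmonoid.subset_closure (Or.inl ⟨hc, ?_⟩)
      calc c * c = c * q * c := by rw [mul_assoc, hqc]
        _ = 0 := by rw [hcq, zero_mul]
    · intro q u hu v hv hqu huq hvq hqv
      refine AddSubmonoid.subset_closure (Or.inr ⟨u, hu, v, hv, ?_, ?_, rfl⟩)
      · calc u * u = u * q * u := by rw [mul_assoc, hqu]
          _ = 0 := by rw [huq, zero_mul]
      · calc v * v = v * q * v := by rw [hvq]
          _ = 0 := by rw [mul_assoc, hqv, mul_zero]
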